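/- Let $k$ be an algebraically closed field, let $S = \operatorname{Spec} k$, and let $\pi : X \to S$ be a proper morphism of schemes with $X$ reduced. All sheaves are sheaves on small étale sites. A logarithmic structure on $X$ is a sheaf of commutative monoids $M$ on $X$ with a homomorphism $\alpha : M \to \mathcal O_X$ to the multiplicative monoid of the structure sheaf such that $\alpha^{-1}(\mathcal O_X^*) \to \mathcal O_X^*$ is an isomorphism. It is coherent if, étale locally on $X$, it is the logarithmic structure associated to a homomorphism $P \to \Gamma(U, M) \to \Gamma(U, \mathcal O_U)$ for some finitely generated commutative monoid $P$. Its characteristic sheaf is $\overline M = M / \mathcal O_X^*$. Let $\pi^* \mathcal O_S^*$ be the sheaf-theoretic inverse image of $\mathcal O_S^*$, with its canonical homomorphism $\pi^*\mathcal O_S^* \to \mathcal O_X^*$. If $M$ is a coherent logarithmic structure on $X$, then every homomorphism of sheaves of monoids $\overline M \to \mathcal O_X^*$ factors through $\pi^* \mathcal O_S^* \to \mathcal O_X^*$. -/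

import Mathlib

open CategoryTheory AlgebraicGeometry Opposite Limits

universe w v u

noncomputable section

namespace LogUnits

/-! ### The category of commutative monoids

Small colimits in `CommMonCat` (needed to sheafify and to pull back sheaves of commutative
monoids), and the functor of units. -/

section Colimits

variable {J : Type u} [Category.{u} J] (F : J ⥤ CommMonCat.{u})

/-- The relations that define the colimit of `F` as a quotient of the free commutative monoid on
the disjoint union of the monoids `F.obj j`. -/
def colimRel :
    Multiplicative (Multiset (Σ j, F.obj j)) → Multiplicative (Multiset (Σ j, F.obj j)) → Prop :=
  fun a b =>
    (∃ (j : J) (x y : F.obj j), a = Multiplicative.ofAdd {⟨j, x * y⟩} ∧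
      b = Multiplicative.ofAdd ({⟨j, x⟩} + {⟨j, y⟩})) ∨
    (∃ j : J, a = Multiplicative.ofAdd {⟨j, 1⟩} ∧ b = 1) ∨
    (∃ (j j' : J) (f : j ⟶ j') (x : F.obj j), a = Multiplicative.ofAdd {⟨j', F.map f x⟩} ∧
      b = Multiplicative.ofAdd {⟨j, x⟩})

abbrev Colim : Type u := (conGen (colimRel F)).Quotient

def colimι (j : J) : F.obj j →* Colim F where
  toFun x := (conGen (colimRel F)).mk' (Multiplicative.ofAdd {⟨j, x⟩})
  map_one' := (Con.eq _).2 (ConGen.Rel.of _ _ (Or.inr (Or.inl ⟨j, rfl, rfl⟩)))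
  map_mul' x y := (Con.eq _).2 (ConGen.Rel.of _ _ (Or.inl ⟨j, x, y, rfl, rfl⟩))

def colimCocone : Cocone F where
  pt := CommMonCat.of (Colim F)
  ι :=
    { app := fun j => CommMonCat.ofHom (colimι F j)
      naturality := by
        intro j j' f
        ext x
        exact (Con.eq _).2 (ConGen.Rel.of _ _ (Or.inr (Or.inr ⟨j, j', f, x, rfl, rfl⟩))) }

def preDesc (s : Cocone F) : Multiplicative (Multiset (Σ j, F.obj j)) →* s.pt where
  toFun m := (m.toAdd.map fun p => s.ι.app p.1 p.2).prod
  map_one' := by simp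
  map_mul' a b := by simp

def colimDesc (s : Cocone F) : Colim F →* s.pt :=
  (conGen (colimRel F)).lift (preDesc F s) (by
    refine Con.conGen_le.2 ?_
    rintro a b (⟨j, x, y, rfl, rfl⟩ | ⟨j, rfl, rfl⟩ | ⟨j, j', f, x, rfl, rfl⟩)
    · simp [Con.ker_rel, preDesc]
    · simp [Con.ker_rel, preDesc]
    · simp [Con.ker_rel, preDesc])

def colimIsColimit : IsColimit (colimCocone F) where
  desc s := CommMonCat.ofHom (colimDesc F s)
  fac s j := by
    ext x
    exact Multiset.prod_singleton _
  uniq s m hm := by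
    let m' : Colim F →* s.pt := m.hom
    suffices h : m' = colimDesc F s from CommMonCat.hom_ext h
    ext a
    have h2 : m' (colimι F a.1 a.2) = s.ι.app a.1 a.2 := congrArg (fun g => g a.2) (hm a.1)
    have h3 : colimDesc F s (colimι F a.1 a.2) = s.ι.app a.1 a.2 := Multiset.prod_singleton _
    exact h2.trans h3.symm

instance hasColimits_commMonCat : HasColimits CommMonCat.{u} where
  has_colimits_of_shape _ _ := { has_colimit := fun F => ⟨⟨colimCocone F, colimIsColimit F⟩⟩ }

end Colimits

instance reflectsLimits_forget : ReflectsLimitsOfSize.{w, v} (forget CommMonCat.{u}) where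
  reflectsLimitsOfShape {J _} := ⟨fun {F} => ⟨fun {c} t => by
    have : Small.{u} (Functor.sections (F ⋙ forget CommMonCat)) :=
      small_of_injective (Types.isLimitEquivSections t).symm.injective
    exact ⟨isLimitOfReflects (forget CommMonCat) t⟩⟩⟩

instance preservesLimits_forget₂ :
    PreservesLimitsOfSize.{w, v} (forget₂ CommGrpCat.{u} CommMonCat.{u}) := by
  have : PreservesLimitsOfSize.{w, v}
      (forget₂ CommGrpCat.{u} CommMonCat.{u} ⋙ forget CommMonCat.{u}) :=
    inferInstanceAs (PreservesLimitsOfSize.{w, v} (forget CommGrpCat.{u}))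
  exact preservesLimits_of_reflects_of_preserves _ (forget CommMonCat.{u})

/-- The functor that sends a commutative monoid to its group of units. -/
abbrev unitsFunctor : CommMonCat.{u} ⥤ CommMonCat.{u} :=
  CommMonCat.units ⋙ forget₂ CommGrpCat CommMonCat

instance preservesLimits_unitsFunctor : PreservesLimitsOfSize.{w, v} unitsFunctor.{u} := by
  have : PreservesLimitsOfSize.{w, v} CommMonCat.units.{u} :=
    CommGrpCat.forget₂CommMonAdj.rightAdjoint_preservesLimits
  exact comp_preservesLimits _ _

/-- The functor that sends a commutative monoid `A` to its quotient `A / Aˣ` by its units. -/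
def quotientByUnits : CommMonCat.{u} ⥤ CommMonCat.{u} where
  obj A := CommMonCat.of (Associates A)
  map {A B} f := CommMonCat.ofHom
    { toFun := Quotient.map' f fun _ _ h => Associated.map f.hom h
      map_one' := congrArg Associates.mk (map_one f.hom)
      map_mul' := by
        rintro ⟨a⟩ ⟨b⟩
        exact congrArg Associates.mk (map_mul f.hom a b) }
  map_id A := by
    ext ⟨a⟩
    rfl
  map_comp f g := by
    ext ⟨a⟩
    rfl

/-! ### The structure sheaf and the sheaf of units on the small étale site -/

section Etale

/-- Étale morphisms, as a property of morphisms of schemes. -/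
abbrev EtaleProp : MorphismProperty Scheme.{u} := @AlgebraicGeometry.Etale

instance etaleProp_respectsIso : MorphismProperty.RespectsIso EtaleProp.{u} := by infer_instance

instance etaleProp_isStableUnderBaseChange :
    MorphismProperty.IsStableUnderBaseChange EtaleProp.{u} := by infer_instance

instance etaleProp_isMultiplicative : MorphismProperty.IsMultiplicative EtaleProp.{u} := by
  infer_instance

variable {X S : Scheme.{u}}

/-- The presheaf `V ↦ Γ(V, 𝒪_V)` of multiplicative monoids on the category of schemes. -/
abbrev monPresheaf : Scheme.{u}ᵒᵖ ⥤ CommMonCat.{u} :=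
  Scheme.Γ ⋙ forget₂ CommRingCat CommMonCat

/-- The presheaf `V ↦ Γ(V, 𝒪_V)` of sets is represented by the affine line over `ℤ`. -/
def monPresheafRep : (monPresheaf.{u} ⋙ forget CommMonCat).RepresentableBy
    (Spec (CommRingCat.of (MvPolynomial PUnit.{u+1} (ULift.{u} ℤ)))) where
  homEquiv {V} := (AffineSpace.toSpecMvPolyIntEquiv PUnit.{u+1} (X := V)).trans
    (Equiv.funUnique PUnit.{u+1} Γ(V, ⊤))
  homEquiv_comp _ _ := rfl

lemma monPresheaf_isSheaf : Presheaf.IsSheaf Scheme.etaleTopology.{u} monPresheaf.{u} := by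
  refine Presheaf.isSheaf_of_isSheaf_comp _ _ (forget CommMonCat.{u}) ?_
  rw [isSheaf_iff_isSheaf_of_type]
  have : (monPresheaf.{u} ⋙ forget CommMonCat).IsRepresentable := monPresheafRep.isRepresentable
  have : Scheme.etaleTopology.{u}.Subcanonical :=
    .of_le (Scheme.etaleTopology_le_proetaleTopology.trans Scheme.proetaleTopology_le_fpqcTopology)
  exact GrothendieckTopology.Subcanonical.isSheaf_of_isRepresentable _

instance forget_isContinuous (X : Scheme.{u}) :
    (Scheme.Etale.forget X).IsContinuous X.smallEtaleTopology (Scheme.etaleTopology.over X) := by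
  have : RepresentablyFlat (Scheme.Etale.forget X) := flat_of_preservesFiniteLimits _
  have : (Scheme.Etale.forget X).LocallyCoverDense (Scheme.etaleTopology.over X) :=
    Scheme.locallyCoverDense_of_le (P := EtaleProp) (Q := EtaleProp) X le_rfl
  rw [Functor.isContinuous_iff_coverPreserving]
  exact Functor.coverPreserving_restrictedTopology (Scheme.Etale.forget X)
    (Scheme.etaleTopology.over X)

/-- The functor from the small étale site of `X` to schemes that forgets the map to `X`. -/
abbrev toScheme (X : Scheme.{u}) : X.Etale ⥤ Scheme.{u} := Scheme.Etale.forget X ⋙ Over.forget X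

instance toScheme_isContinuous (X : Scheme.{u}) :
    (toScheme X).IsContinuous X.smallEtaleTopology Scheme.etaleTopology :=
  Functor.isContinuous_comp _ _ _ (Scheme.etaleTopology.over X) _

variable (X) in
/-- The étale structure sheaf `𝒪_X`, as a sheaf of multiplicative monoids: its sections over an
étale `V ⟶ X` are the elements of `Γ(V, 𝒪_V)`. -/
def structureSheaf : Sheaf X.smallEtaleTopology CommMonCat.{u} :=
  ((toScheme X).sheafPushforwardContinuous CommMonCat.{u} X.smallEtaleTopology
    Scheme.etaleTopology).obj ⟨monPresheaf, monPresheaf_isSheaf⟩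

variable (X) in
/-- The étale sheaf of units `𝒪_X^*`: its sections over an étale `V ⟶ X` are the units of
`Γ(V, 𝒪_V)`. -/
def unitsSheaf : Sheaf X.smallEtaleTopology CommMonCat.{u} :=
  (sheafCompose X.smallEtaleTopology unitsFunctor.{u}).obj (structureSheaf X)

/-! ### Inverse image along a morphism of schemes -/

/-- The base change functor `V ↦ V ×_S X` between small étale sites. -/
def baseChange (f : X ⟶ S) : S.Etale ⥤ X.Etale := MorphismProperty.Over.pullback EtaleProp ⊤ f

def baseChangeForget (f : X ⟶ S) : baseChange f ⋙ Scheme.Etale.forget X ≅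
    Scheme.Etale.forget S ⋙ Over.pullback f :=
  MorphismProperty.Over.pullbackCompForgetIso f

instance baseChange_preservesFiniteLimits (f : X ⟶ S) : PreservesFiniteLimits (baseChange f) := by
  have : PreservesFiniteLimits (baseChange f ⋙ Scheme.Etale.forget X) :=
    preservesFiniteLimits_of_natIso (baseChangeForget f).symm
  exact preservesFiniteLimits_of_reflects_of_preserves _ (Scheme.Etale.forget X)

lemma mem_range_map {A B S X : Scheme.{u}} (a : A ⟶ S) (b : B ⟶ S) (f : X ⟶ S) (g : A ⟶ B)
    (h : g ≫ b = a) (z : ↥(pullback b f)) (y : A) (hy : g y = pullback.fst b f z) :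
    z ∈ Set.range (pullback.map a f b f g (𝟙 X) (𝟙 S) (by simp [h]) (by simp)) := by
  rw [Scheme.Pullback.range_map]
  exact ⟨⟨y, hy⟩, pullback.snd b f z, by simp⟩

instance baseChange_isContinuous (f : X ⟶ S) :
    (baseChange f).IsContinuous S.smallEtaleTopology X.smallEtaleTopology := by
  have : RepresentablyFlat (baseChange f) := flat_of_preservesFiniteLimits _
  rw [Functor.isContinuous_iff_coverPreserving]
  refine ⟨fun {V R} hR => ?_⟩
  obtain ⟨ι, Z, g, rfl⟩ := R.exists_eq_ofArrows
  rw [Scheme.ofArrows_mem_smallEtaleTopology_iff] at hR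
  rw [Sieve.functorPushforward_ofArrows, Scheme.ofArrows_mem_smallEtaleTopology_iff]
  refine Set.eq_univ_of_forall fun (z : ↥(pullback V.hom f)) => ?_
  obtain ⟨i, y, hy⟩ := Set.mem_iUnion.1 (hR ▸ Set.mem_univ ((pullback.fst V.hom f) z))
  have h1 : (g i).left ≫ V.hom = (Z i).hom := MorphismProperty.Over.w (P := EtaleProp) (g i)
  have h2 : ((baseChange f).map (g i)).left =
      pullback.map (Z i).hom f V.hom f (g i).left (𝟙 X) (𝟙 S) (by simp [h1]) (by simp) := by
    apply pullback.hom_ext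
    · exact (pullback.lift_fst _ _ _).trans (pullback.lift_fst _ _ _).symm
    · exact (pullback.lift_snd _ _ _).trans
        ((Category.comp_id _).symm.trans (pullback.lift_snd _ _ _).symm)
  refine Set.mem_iUnion.2 ⟨i, ?_⟩
  rw [h2]
  exact mem_range_map (Z i).hom V.hom f (g i).left h1 z y hy

instance affine_baseChange_isContinuous (f : X ⟶ S) :
    (Scheme.AffineEtale.Spec S ⋙ baseChange f).IsContinuous
      (Scheme.AffineEtale.topology S) X.smallEtaleTopology :=
  Functor.isContinuous_comp _ _ _ S.smallEtaleTopology _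

instance affine_baseChange_hasLeftKanExtension (f : X ⟶ S)
    (F : S.AffineEtaleᵒᵖ ⥤ CommMonCat.{u}) :
    (Scheme.AffineEtale.Spec S ⋙ baseChange f).op.HasLeftKanExtension F := by
  have (Y : X.Etaleᵒᵖ) : HasColimitsOfShape
      (CostructuredArrow (Scheme.AffineEtale.Spec S ⋙ baseChange f).op Y) CommMonCat.{u} :=
    hasColimitsOfShape_of_essentiallySmall.{u} _ _
  infer_instance

/-- The direct image of étale sheaves of commutative monoids along `f` has a left adjoint. -/
instance pushforward_isRightAdjoint (f : X ⟶ S) :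
    ((baseChange f).sheafPushforwardContinuous CommMonCat.{u}
      S.smallEtaleTopology X.smallEtaleTopology).IsRightAdjoint := by
  let e := (Scheme.AffineEtale.Spec S).sheafPushforwardContinuous CommMonCat.{u}
    (Scheme.AffineEtale.topology S) S.smallEtaleTopology
  let p := (baseChange f).sheafPushforwardContinuous CommMonCat.{u}
    S.smallEtaleTopology X.smallEtaleTopology
  have h : (p ⋙ e).IsRightAdjoint := inferInstanceAs
    ((Scheme.AffineEtale.Spec S ⋙ baseChange f).sheafPushforwardContinuous CommMonCat.{u}
      (Scheme.AffineEtale.topology S) X.smallEtaleTopology).IsRightAdjoint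
  exact (Functor.isRightAdjoint_comp_iff_left p e).1 h

lemma units_map_comm {A B C D : Scheme.{u}} (a : A ⟶ B) (b : B ⟶ D) (c : A ⟶ C) (d : C ⟶ D)
    (h : a ≫ b = c ≫ d) :
    unitsFunctor.{u}.map (monPresheaf.map b.op) ≫ unitsFunctor.{u}.map (monPresheaf.map a.op) =
      unitsFunctor.{u}.map (monPresheaf.map d.op) ≫
        unitsFunctor.{u}.map (monPresheaf.map c.op) := by
  rw [← Functor.map_comp, ← Functor.map_comp, ← Functor.map_comp, ← Functor.map_comp, ← op_comp,
    ← op_comp, h]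

/-- The pullback of functions `𝒪_S^* ⟶ f_* 𝒪_X^*`. -/
def unitsToPushforward (f : X ⟶ S) : unitsSheaf S ⟶
    ((baseChange f).sheafPushforwardContinuous CommMonCat.{u} S.smallEtaleTopology
      X.smallEtaleTopology).obj (unitsSheaf X) :=
  ⟨{ app V := unitsFunctor.{u}.map (monPresheaf.map (pullback.fst V.unop.hom f).op)
     naturality {V W} g := by
      have h : ((baseChange f).map g.unop).left ≫ pullback.fst V.unop.hom f =
          pullback.fst W.unop.hom f ≫ g.unop.left := pullback.lift_fst _ _ _
      exact (units_map_comm _ _ _ _ h).symm }⟩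

/-- The sheaf-theoretic inverse image `π^* 𝒪_S^*` of the sheaf of units of `S` on the small étale
site of `X`. -/
def inverseImageUnits (π : X ⟶ S) : Sheaf X.smallEtaleTopology CommMonCat.{u} :=
  ((baseChange π).sheafPullback CommMonCat.{u} S.smallEtaleTopology X.smallEtaleTopology).obj
    (unitsSheaf S)

/-- The canonical homomorphism `π^* 𝒪_S^* ⟶ 𝒪_X^*`, adjoint to the pullback of functions. -/
def inverseImageUnitsHom (π : X ⟶ S) : inverseImageUnits π ⟶ unitsSheaf X :=
  (((baseChange π).sheafAdjunctionContinuous CommMonCat.{u} S.smallEtaleTopology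
    X.smallEtaleTopology).homEquiv _ _).symm (unitsToPushforward π)

end Etale

/-! ### Logarithmic structures -/

section Log

variable {C : Type v} [Category.{w} C] {J : GrothendieckTopology C}

/-- A logarithmic structure on a site with a sheaf of multiplicative monoids `O`: a sheaf of
commutative monoids `M` with a homomorphism `α : M ⟶ O` that restricts to an isomorphism from
`α⁻¹(O^*)` to `O^*`. -/
structure LogStr (O : Sheaf J CommMonCat.{u}) where
  M : Sheaf J CommMonCat.{u}
  α : M ⟶ O
  existsUnique (U : C) (f : O.obj.obj (op U)) :
    IsUnit f → ∃! m : M.obj.obj (op U), α.hom.app (op U) m = f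

namespace LogStr

variable {O : Sheaf J CommMonCat.{u}}

/-- The units of `M` are the sections in `α⁻¹(O^*)`, so that `O^* ≅ M^*`. -/
lemma isUnit_iff (M : LogStr O) (U : C) (m : M.M.obj.obj (op U)) :
    IsUnit m ↔ IsUnit (M.α.hom.app (op U) m) := by
  refine ⟨fun h => h.map (M.α.hom.app (op U)).hom, fun h => ?_⟩
  obtain ⟨n, hn⟩ := h.exists_right_inv
  obtain ⟨m', hm', -⟩ := M.existsUnique U n (IsUnit.of_mul_eq_one_right _ hn)
  refine IsUnit.of_mul_eq_one m' ?_
  refine (M.existsUnique U 1 isUnit_one).unique ?_ (map_one (M.α.hom.app (op U)).hom)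
  exact (map_mul (M.α.hom.app (op U)).hom m m').trans ((congrArg _ hm').trans hn)

/-- Homomorphisms of logarithmic structures: homomorphisms of sheaves of monoids over `O`. -/
structure Hom (M N : LogStr O) where
  hom : M.M ⟶ N.M
  comm : hom ≫ N.α = M.α

/-- The restriction of a logarithmic structure to an object `U` of the site. -/
def restrict (M : LogStr O) (U : C) : LogStr (O.over U) where
  M := M.M.over U
  α := (J.overPullback CommMonCat.{u} U).map M.α
  existsUnique V f hf := M.existsUnique V.left f hf

/-- A homomorphism `θ : P → Γ(U, M)` is a chart of `M` over `U` if it identifies `M|_U` with the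
logarithmic structure associated to the prelogarithmic structure `P → M(U) → O(U)`, that is, if
`θ` is universal among the homomorphisms over `O` from the constant monoid `P` to a logarithmic
structure `N` on `U`. -/
def IsChart (M : LogStr O) (U : C) {P : Type u} [CommMonoid P] (θ : P →* M.M.obj.obj (op U)) :
    Prop :=
  ∀ (N : LogStr (O.over U)) (h : P →* N.M.obj.obj (op (Over.mk (𝟙 U)))),
    (∀ p, N.α.hom.app (op (Over.mk (𝟙 U))) (h p) = M.α.hom.app (op U) (θ p)) →
      ∃! g : (M.restrict U).Hom N, ∀ p, g.hom.hom.app (op (Over.mk (𝟙 U))) (θ p) = h p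

end LogStr

end Log

section Scheme

variable {X : Scheme.{u}}

/-- A logarithmic structure on `X` is coherent if étale locally on `X` it has a chart by a finitely
generated commutative monoid. -/
def LogStr.IsCoherent (M : LogStr (structureSheaf X)) : Prop :=
  ∀ x : X, ∃ (U : X.Etale) (u : U.left), U.hom u = x ∧
    ∃ (P : Type u) (_ : CommMonoid P) (θ : P →* M.M.obj.obj (op U)), Monoid.FG P ∧ M.IsChart U θ

/-- The characteristic sheaf `M̄ = M / 𝒪_X^*`: the sheaf associated to the presheaf that sends `V`
to the quotient of `M(V)` by its units, which are the units of `𝒪_X` over `V` by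
`LogStr.isUnit_iff`. -/
def LogStr.characteristic (M : LogStr (structureSheaf X)) :
    Sheaf X.smallEtaleTopology CommMonCat.{u} :=
  (presheafToSheaf X.smallEtaleTopology CommMonCat.{u}).obj (M.M.obj ⋙ quotientByUnits)

end Scheme

end LogUnits

end

/-! A homomorphism `φ` on the characteristic sheaf amounts to a homomorphism `Φ` from `M` to the
units of the structure sheaf that is trivial on the units of `M`. The point is that every function
`f = Φ(m)` is locally a constant in `k`; the factorization is then formal.

Constant values (`exists_notMem_basicOpen_sub_constants`): suppose `f` on an étale `V` takes at `v`
a value `x` in the residue field `K` that is not in `k`. As `k` is algebraically closed, some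
valuation ring `R` of `K` contains `k` and has `x` as a nonunit. By properness the point `Spec K ⟶
X` extends to `Spec R ⟶ X`. Take a chart `P` on an étale `U` around the image of the closed point;
after a local extension `R'` of `R`, the map from the spectrum lifts to `U`. Over `U ×_X V`, locally
`m` is a unit times some `p` in `P`, so `f` agrees there with `Φ(p)`. But `Φ(p)` is an invertible
function on all of `U`, so its value in `R'` is a unit, and this value is `x`. Hence `x` is a unit
of `R`, a contradiction.

Local constancy (`exists_covering_eq_constants`): `V` is reduced and locally Noetherian, so a
function with values in `k` at all points, generic ones included, is locally constant.

Factorization (`exists_factorization`): no description of the inverse image sheaf is needed, only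
its sections coming from units of `k`. The map to functions is injective on these, so the local
lifts are unique and glue. -/

noncomputable section

namespace LogUnits

/-! ### Subsheaves of monoids and gluing of unique local lifts. -/

section Submonoids

variable {C : Type v} [Category.{w} C] {J : GrothendieckTopology C}

/-- The presheaf of monoids given by a family of submonoids stable under restriction. -/
def subPresheaf (F : Cᵒᵖ ⥤ CommMonCat.{u}) (G : ∀ U, Submonoid (F.obj U))
    (hG : ∀ ⦃U V : Cᵒᵖ⦄ (f : U ⟶ V), G U ≤ (G V).comap (F.map f).hom) : Cᵒᵖ ⥤ CommMonCat.{u} where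
  obj U := CommMonCat.of (G U)
  map f := CommMonCat.ofHom 
    (((F.map f).hom.comp (G _).subtype).codRestrict (G _) fun x => hG f x.2)
  map_id U := by
    refine CommMonCat.hom_ext (MonoidHom.ext fun (x : G U) => ?_)
    have h : F.map (𝟙 U) x.1 = x.1 := by simp
    exact Subtype.ext h
  map_comp f g := by
    refine CommMonCat.hom_ext (MonoidHom.ext fun (x : G _) => ?_)
    have h : F.map (f ≫ g) x.1 = F.map g (F.map f x.1) := by simp
    exact Subtype.ext h

/-- The inclusion of a presheaf of submonoids. -/
def subPresheafι (F : Cᵒᵖ ⥤ CommMonCat.{u}) (G : ∀ U, Submonoid (F.obj U))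
    (hG : ∀ ⦃U V : Cᵒᵖ⦄ (f : U ⟶ V), G U ≤ (G V).comap (F.map f).hom) :
    subPresheaf F G hG ⟶ F where
  app U := CommMonCat.ofHom (G U).subtype
  naturality _ _ _ := rfl

/-- A subpresheaf of a sheaf is a sheaf as soon as membership can be tested on a covering; this may
be checked on underlying sets. -/
lemma subPresheaf_isSheaf (F : Sheaf J CommMonCat.{u}) (G : ∀ U, Submonoid (F.obj.obj U))
    (hG : ∀ ⦃U V : Cᵒᵖ⦄ (f : U ⟶ V), G U ≤ (G V).comap (F.obj.map f).hom)
    (hloc : ∀ (U : C) (x : F.obj.obj (op U)) (S : Sieve U), S ∈ J U →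
      (∀ ⦃W : C⦄ (g : W ⟶ U), S g → F.obj.map g.op x ∈ G (op W)) → x ∈ G (op U)) :
    Presheaf.IsSheaf J (subPresheaf F.obj G hG) := by
  refine Presheaf.isSheaf_of_isSheaf_comp _ _ (forget CommMonCat.{u}) ?_
  let P : Subfunctor (F.obj ⋙ forget CommMonCat.{u}) :=
    { obj U := {x | x ∈ G U}
      map f := fun x hx => hG f hx }
  have hF : Presieve.IsSheaf J (F.obj ⋙ forget CommMonCat.{u}) :=
    (isSheaf_iff_isSheaf_of_type _ _).1
      (Presheaf.isSheaf_comp_of_isSheaf J F.obj (forget CommMonCat.{u}) F.property)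
  have hP : Presheaf.IsSheaf J P.toFunctor := by
    rw [isSheaf_iff_isSheaf_of_type, P.isSheaf_iff hF]
    intro U x hx
    exact hloc U.unop x _ hx fun W g hg => hg
  exact (Presheaf.isSheaf_of_iso_iff (NatIso.ofComponents (fun U => Iso.refl _)
    (fun f => rfl))).1 hP

/-- A homomorphism `φ : A ⟶ O` of sheaves whose values lie locally in the image of a subpresheaf
of `F` on which `i : F ⟶ O` is injective factors through `i`. -/
theorem exists_factorization [J.WEqualsLocallyBijective CommMonCat.{u}]
    {A F O : Sheaf J CommMonCat.{u}} (i : F ⟶ O) (φ : A ⟶ O)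
    (D : ∀ U, Submonoid (F.obj.obj U))
    (hD : ∀ ⦃U V : Cᵒᵖ⦄ (f : U ⟶ V), D U ≤ (D V).comap (F.obj.map f).hom)
    (inj : ∀ (U : Cᵒᵖ), Set.InjOn (i.hom.app U) (D U))
    (loc : ∀ (U : C) (m : A.obj.obj (op U)), ∃ S ∈ J U, ∀ ⦃W : C⦄ (g : W ⟶ U), S g →
      ∃ d ∈ D (op W), i.hom.app _ d = φ.hom.app _ (A.obj.map g.op m)) :
    ∃ ψ : A ⟶ F, ψ ≫ i = φ := by
  have nat {U V : Cᵒᵖ} {A B : Sheaf J CommMonCat.{u}} (a : A ⟶ B) (f : U ⟶ V) (x : A.obj.obj U) :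
      a.hom.app V (A.obj.map f x) = B.obj.map f (a.hom.app U x) := NatTrans.naturality_apply _ _ _
  -- `G` consists of the sections of `A` whose image already lifts to `D` without refinement. The
  -- lift is unique by `inj`, hence multiplicative and compatible with restriction.
  let G : ∀ U, Submonoid (A.obj.obj U) := fun U =>
    ((D U).map (i.hom.app U).hom).comap (φ.hom.app U).hom
  have hG : ∀ ⦃U V : Cᵒᵖ⦄ (f : U ⟶ V), G U ≤ (G V).comap (A.obj.map f).hom := by
    rintro U V f x ⟨d, hd, hdx⟩
    exact ⟨F.obj.map f d, hD f hd, (nat i f d).trans ((congrArg _ hdx).trans (nat φ f x).symm)⟩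
  choose d hd hdx using fun (U : Cᵒᵖ) (x : G U) => x.2
  have d_eq {U : Cᵒᵖ} (x : G U) {y : F.obj.obj U} (hy : y ∈ D U)
      (h : i.hom.app U y = φ.hom.app U x) : d U x = y :=
    inj U (hd U x) hy ((hdx U x).trans h.symm)
  let χ : subPresheaf A.obj G hG ⟶ F.obj :=
    { app U := CommMonCat.ofHom
        { toFun := d U
          map_one' := d_eq _ (one_mem _) ((map_one (i.hom.app U).hom).trans
            (map_one (φ.hom.app U).hom).symm)
          map_mul' x y := d_eq _ (mul_mem (hd U x) (hd U y)) ((map_mul (i.hom.app U).hom _ _).trans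
            ((congrArg₂ _ (hdx U x) (hdx U y)).trans (map_mul (φ.hom.app U).hom _ _).symm)) }
      naturality U V f := by
        ext x
        refine d_eq _ (hD f (hd U x)) ?_
        exact (nat i f _).trans ((congrArg _ (hdx U x)).trans (nat φ f _).symm) }
  let ι := subPresheafι A.obj G hG
  -- By `loc`, `G` contains every section of `A` locally, so its inclusion becomes an isomorphism on
  -- sheafification, and maps from `G` to a sheaf extend uniquely to `A`.
  have hW : J.W ι := by
    refine (J.W_iff_isLocallyBijective ι).2 ⟨?_, ?_⟩
    · exact Presheaf.isLocallyInjective_of_injective J ι fun U x y h => Subtype.ext h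
    · refine ⟨fun {U} s => ?_⟩
      obtain ⟨S, hS, h⟩ := loc U s
      refine J.superset_covering (fun W g hg => ?_) hS
      exact ⟨⟨A.obj.map g.op s, h g hg⟩, rfl⟩
  obtain ⟨ψ, hψ⟩ := (hW F.obj F.property).2 χ
  refine ⟨⟨ψ⟩, Sheaf.hom_ext ?_⟩
  refine (hW O.obj O.property).1 ?_
  change ι ≫ ψ ≫ i.hom = ι ≫ φ.hom
  rw [← Category.assoc]
  refine (congrArg (· ≫ i.hom) hψ).trans ?_
  ext U x
  exact hdx U x

end Submonoids

/-! ### A chart generates the logarithmic structure. -/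

section Charts

variable {C : Type v} [Category.{w} C] {J : GrothendieckTopology C} {O : Sheaf J CommMonCat.{u}}

/-- The sections over `V` that agree up to a unit with an element of `P`. -/
def generatedSubmonoid (F : Cᵒᵖ ⥤ CommMonCat.{u}) {P : Type u} [CommMonoid P] {V : Cᵒᵖ}
    (θ : P →* F.obj V) : Submonoid (F.obj V) where
  carrier := {m | ∃ (p : P) (e : F.obj V), IsUnit e ∧ m = e * θ p}
  one_mem' := ⟨1, 1, isUnit_one, by simp⟩
  mul_mem' := by
    rintro _ _ ⟨p, e, he, rfl⟩ ⟨q, e', he', rfl⟩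
    exact ⟨p * q, e * e', he.mul he', by rw [map_mul, mul_mul_mul_comm]⟩

namespace LogStr

/-- Sections that locally agree up to a unit with an element of `P`. -/
def locallyGenerated (M : LogStr O) (U : C) {P : Type u} [CommMonoid P]
    (θ : P →* M.M.obj.obj (op U)) (V : (Over U)ᵒᵖ) : Submonoid ((M.restrict U).M.obj.obj V) where
  carrier := {m | ∃ S ∈ (J.over U) V.unop, ∀ ⦃W : Over U⦄ (g : W ⟶ V.unop), S g →
    (M.restrict U).M.obj.map g.op m ∈
      generatedSubmonoid (M.restrict U).M.obj (V := op W) ((M.M.obj.map W.hom.op).hom.comp θ)}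
  one_mem' := ⟨⊤, (J.over U).top_mem _, fun W g _ => by
    rw [map_one]
    exact one_mem _⟩
  mul_mem' := by
    rintro a b ⟨S, hS, h⟩ ⟨T, hT, h'⟩
    refine ⟨S ⊓ T, (J.over U).intersection_covering hS hT, fun W g hg => ?_⟩
    rw [map_mul]
    exact mul_mem (h g hg.1) (h' g hg.2)

lemma locallyGenerated_map (M : LogStr O) (U : C) {P : Type u} [CommMonoid P]
    (θ : P →* M.M.obj.obj (op U)) ⦃V V' : (Over U)ᵒᵖ⦄ (f : V ⟶ V') :
    M.locallyGenerated U θ V ≤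
      (M.locallyGenerated U θ V').comap ((M.restrict U).M.obj.map f).hom := by
  rintro m ⟨S, hS, h⟩
  refine ⟨S.pullback f.unop, (J.over U).pullback_stable _ hS, fun W g hg => ?_⟩
  have := h _ hg
  rw [op_comp, Functor.map_comp] at this
  exact this

lemma locallyGenerated_local (M : LogStr O) (U : C) {P : Type u} [CommMonoid P]
    (θ : P →* M.M.obj.obj (op U)) (V : Over U) (x : (M.restrict U).M.obj.obj (op V)) (S : Sieve V)
    (hS : S ∈ (J.over U) V)
    (h : ∀ ⦃W : Over U⦄ (g : W ⟶ V), S g →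
      (M.restrict U).M.obj.map g.op x ∈ M.locallyGenerated U θ (op W)) :
    x ∈ M.locallyGenerated U θ (op V) := by
  choose T hT hT' using h
  refine ⟨Sieve.bind S T, (J.over U).bind_covering hS (fun _ _ hg => hT _ hg), ?_⟩
  rintro W _ ⟨Y, g, f, hf, hg, rfl⟩
  have := hT' f hf g hg
  rw [op_comp, Functor.map_comp]
  exact this

lemma isUnit_mem_locallyGenerated (M : LogStr O) (U : C) {P : Type u} [CommMonoid P]
    (θ : P →* M.M.obj.obj (op U)) (V : (Over U)ᵒᵖ) (m : (M.restrict U).M.obj.obj V)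
    (hm : IsUnit m) : m ∈ M.locallyGenerated U θ V :=
  ⟨⊤, (J.over U).top_mem _, fun W g _ =>
    ⟨1, _, hm.map ((M.restrict U).M.obj.map g.op).hom, 
      (mul_one _).symm.trans
        (congrArg _ (map_one ((M.M.obj.map W.hom.op).hom.comp θ)).symm)⟩⟩

/-- The inclusion of the sheaf of locally generated sections. -/
def locallyGeneratedι (M : LogStr O) (U : C) {P : Type u} [CommMonoid P]
    (θ : P →* M.M.obj.obj (op U)) :
    (⟨subPresheaf (M.restrict U).M.obj (M.locallyGenerated U θ) (M.locallyGenerated_map U θ),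
      subPresheaf_isSheaf _ _ _ (M.locallyGenerated_local U θ)⟩ :
        Sheaf (J.over U) CommMonCat.{u}) ⟶ (M.restrict U).M :=
  ⟨subPresheafι _ _ (M.locallyGenerated_map U θ)⟩

/-- The logarithmic structure on `U` generated by the units and the elements of `P`. -/
def generatedLogStr (M : LogStr O) (U : C) {P : Type u} [CommMonoid P]
    (θ : P →* M.M.obj.obj (op U)) : LogStr (O.over U) where
  M := ⟨subPresheaf (M.restrict U).M.obj (M.locallyGenerated U θ) (M.locallyGenerated_map U θ),
    subPresheaf_isSheaf _ _ _ (M.locallyGenerated_local U θ)⟩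
  α := M.locallyGeneratedι U θ ≫ (M.restrict U).α
  existsUnique V f hf := by
    obtain ⟨m, hm, hm'⟩ := (M.restrict U).existsUnique V f hf
    have hu : IsUnit m := ((M.restrict U).isUnit_iff V m).2 (by rwa [hm])
    exact ⟨⟨m, M.isUnit_mem_locallyGenerated U θ _ m hu⟩, hm, fun y hy => Subtype.ext (hm' _ hy)⟩

/-- The monoid `P` of a chart generates the logarithmic structure locally and up to units. -/
theorem IsChart.exists_eq_mul (M : LogStr O) {U : C} {P : Type u} [CommMonoid P]
    {θ : P →* M.M.obj.obj (op U)} (h : M.IsChart U θ) {V : C} (f : V ⟶ U)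
    (m : M.M.obj.obj (op V)) :
    ∃ S ∈ J V, ∀ ⦃W : C⦄ (g : W ⟶ V), S g → ∃ (p : P) (e : M.M.obj.obj (op W)), IsUnit e ∧
      M.M.obj.map g.op m = e * M.M.obj.map (g ≫ f).op (θ p) := by
  let N := M.generatedLogStr U θ
  let j : N.Hom (M.restrict U) := ⟨M.locallyGeneratedι U θ, rfl⟩
  have hθ (p : P) : θ p ∈ M.locallyGenerated U θ (op (Over.mk (𝟙 U))) :=
    ⟨⊤, (J.over U).top_mem _, fun W g _ => ⟨p, 1, isUnit_one, by
      have : g.left = W.hom := by simpa using Over.w g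
      rw [one_mul, ← this]
      rfl⟩⟩
  obtain ⟨g, hg, -⟩ := h N (θ.codRestrict (M.locallyGenerated U θ (op (Over.mk (𝟙 U)))) hθ)
    (fun p => rfl)
  -- The universal property with target `M` itself: the composite of `g` with the inclusion of `N`
  -- and the identity both extend `θ`, so they coincide, and every section of `M` lies in `N`.
  obtain ⟨r, -, hr⟩ := h (M.restrict U) θ (fun p => rfl)
  have h1 := hr ⟨g.hom ≫ j.hom, by rw [Category.assoc, j.comm, g.comm]⟩
    (fun p => congrArg Subtype.val (hg p))
  have h2 := hr ⟨𝟙 _, Category.id_comp _⟩ (fun p => rfl)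
  have h3 : g.hom ≫ j.hom = 𝟙 _ := congrArg Hom.hom (h1.trans h2.symm)
  have h4 : (g.hom.hom.app (op (Over.mk f)) m).1 = m :=
    congrArg (fun t : (M.restrict U).M ⟶ (M.restrict U).M => t.hom.app (op (Over.mk f)) m) h3
  obtain ⟨S, hS, hS'⟩ := (g.hom.hom.app (op (Over.mk f)) m).2
  rw [h4] at hS'
  refine ⟨Sieve.overEquiv _ S, hS, fun W t ht => ?_⟩
  rw [Sieve.overEquiv_iff] at ht
  obtain ⟨p, e, he, hpe⟩ := hS' _ ht
  exact ⟨p, e, he, hpe⟩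

end LogStr

end Charts

/-! ### Functions with values in the base field on reduced Noetherian schemes. -/

section Geometry

lemma isReduced_of_etale_field {K : Type u} [Field K] {X : Scheme.{u}}
    (f : X ⟶ Spec (CommRingCat.of K)) [AlgebraicGeometry.Etale f] : IsReduced X := by
  have key (R : CommRingCat.{u}) (g : Spec R ⟶ Spec (CommRingCat.of K))
      (hg : AlgebraicGeometry.Etale g) : IsReduced (Spec R) := by
    obtain ⟨φ, rfl⟩ := Spec.map_surjective g
    rw [HasRingHomProperty.Spec_iff (P := @AlgebraicGeometry.Etale)] at hg
    algebraize [φ.hom]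
    have : Algebra.Etale K R := ‹_›
    have := Algebra.FormallyUnramified.isReduced_of_field K R
    infer_instance
  have (i : X.affineCover.I₀) : IsReduced (X.affineCover.X i) := by
    have h : IsOpenImmersion (X.affineCover.f i) := inferInstance
    have h' : AlgebraicGeometry.Etale (X.affineCover.f i) := inferInstance
    exact key _ (X.affineCover.f i ≫ f) (MorphismProperty.comp_mem EtaleProp _ _ h' ‹_›)
  exact IsReduced.of_openCover _ X.affineCover

/-- Base changes to fields are étale over a field, hence reduced. This serves to show that schemes
étale over the reduced `X` are reduced. -/
instance geometricallyReduced_of_etale {X Y : Scheme.{u}} (f : X ⟶ Y)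
    [AlgebraicGeometry.Etale f] : GeometricallyReduced f where
  geometrically_isReduced K _ y p q r h := by
    have : AlgebraicGeometry.Etale r :=
      MorphismProperty.of_isPullback (P := @AlgebraicGeometry.Etale) h ‹_›
    exact isReduced_of_etale_field r

/-- There are finitely many minimal primes, so `f` takes finitely many values at them. Let `g` be
the product of the `f - t` over those values `t` other than the value at `q`. Then `g * (f - c q)`
lies in every minimal prime, so it vanishes in the reduced ring `A`. -/
lemma exists_mul_sub_eq_zero {k A : Type*} [Field k] [CommRing A] [IsNoetherianRing A]
    [IsReduced A] (ι : k →+* A) (f : A)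
    (hf : ∀ p : PrimeSpectrum A, ∃ c, f - ι c ∈ p.asIdeal) (q : PrimeSpectrum A) :
    ∃ g ∉ q.asIdeal, ∃ c, g * (f - ι c) = 0 := by
  classical
  choose c hc using hf
  have hfin : Finite (minimalPrimes A) := minimalPrimes.finite_of_isNoetherianRing A
  have := Fintype.ofFinite (minimalPrimes A)
  let pt (p : minimalPrimes A) : PrimeSpectrum A := ⟨p.1, p.2.1.1⟩
  let T := (Finset.univ.image fun p => c (pt p)).erase (c q)
  refine ⟨∏ t ∈ T, (f - ι t), fun h => ?_, c q, ?_⟩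
  -- A factor `f - t` in `q` would put the nonzero constant `t - c q` in `q`.
  · obtain ⟨t, ht, htq⟩ := (q.2.prod_mem_iff).1 h
    have h1 : ι (t - c q) ∈ q.asIdeal := by
      have := q.asIdeal.sub_mem (hc q) htq
      rwa [sub_sub_sub_cancel_left, ← map_sub] at this
    have h2 : t - c q ≠ 0 := sub_ne_zero.2 (Finset.ne_of_mem_erase ht)
    exact q.2.ne_top (Ideal.eq_top_of_isUnit_mem _ h1 ((IsUnit.mk0 _ h2).map ι))
  · have h0 : (∏ t ∈ T, (f - ι t)) * (f - ι (c q)) ∈ nilradical A := by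
      rw [nilradical, ← Ideal.sInf_minimalPrimes]
      refine Ideal.mem_sInf.2 fun {p} (hp : p ∈ minimalPrimes A) => ?_
      by_cases h : c (pt ⟨p, hp⟩) = c q
      · exact p.mul_mem_left _ (h ▸ hc (pt ⟨p, hp⟩))
      · exact p.mul_mem_right _ (p.mem_of_dvd (Finset.dvd_prod_of_mem _ (Finset.mem_erase.2
          ⟨h, Finset.mem_image_of_mem _ (Finset.mem_univ _)⟩)) (hc (pt ⟨p, hp⟩)))
    rwa [nilradical_eq_zero] at h0

/-- On an affine neighbourhood, `exists_mul_sub_eq_zero` gives `g * (f - c) = 0` with `g`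
nonvanishing at `v`; inverting `g` gives `f = c`. -/
lemma exists_res_sub_eq_zero {k : Type*} [Field k] {V : Scheme.{u}} [IsReduced V]
    [IsLocallyNoetherian V] (ι : k →+* Γ(V, ⊤)) (f : Γ(V, ⊤))
    (hf : ∀ v : V, ∃ c, v ∉ V.basicOpen (f - ι c)) (v : V) :
    ∃ W : V.Opens, v ∈ W ∧ ∃ c, W.ι.appTop f = W.ι.appTop (ι c) := by
  obtain ⟨_, ⟨U, hU, rfl⟩, hv, -⟩ :=
    V.isBasis_affineOpens.exists_subset_of_mem_open (Set.mem_univ v) isOpen_univ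
  have := IsLocallyNoetherian.component_noetherian ⟨U, hU⟩
  let r : Γ(V, ⊤) →+* Γ(V, U) := (V.presheaf.map (homOfLE le_top).op).hom
  have key (p : PrimeSpectrum Γ(V, U)) (s : Γ(V, U)) :
      hU.fromSpec p ∈ V.basicOpen s ↔ s ∉ p.asIdeal := by
    change p ∈ hU.fromSpec ⁻¹ᵁ V.basicOpen s ↔ _
    rw [hU.fromSpec_preimage_basicOpen]
    rfl
  obtain ⟨q, hq⟩ : v ∈ Set.range hU.fromSpec := by rwa [hU.range_fromSpec]
  obtain ⟨g, hg, c, hc⟩ := exists_mul_sub_eq_zero (r.comp ι) (r f) (fun p => by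
    obtain ⟨c, hc⟩ := hf (hU.fromSpec p)
    refine ⟨c, by_contra fun h => hc ?_⟩
    rw [RingHom.comp_apply, ← map_sub, ← key] at h
    exact V.basicOpen_restrict (homOfLE le_top) _ h) q
  refine ⟨V.basicOpen g, hq ▸ (key q g).2 hg, c, ?_⟩
  have hu := RingedSpace.isUnit_res_basicOpen V.toRingedSpace g
  have h := congrArg (V.presheaf.map (homOfLE (V.basicOpen_le g)).op).hom hc
  rw [map_mul, map_zero] at h
  have h' := (hu.mul_right_eq_zero).1 h
  let W := V.basicOpen g
  have hW : W.ι.appTop = V.presheaf.map (homOfLE le_top).op ≫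
      V.presheaf.map (homOfLE (V.basicOpen_le g)).op ≫
        V.presheaf.map (homOfLE (x := W.ι ''ᵁ ⊤) (y := W) (by simp)).op := by
    rw [← Functor.map_comp, ← Functor.map_comp]
    rfl
  have h2 := congrArg (V.presheaf.map (homOfLE (x := W.ι ''ᵁ ⊤) (y := W) (by simp)).op).hom h'
  refine sub_eq_zero.1 ((map_sub W.ι.appTop.hom _ _).symm.trans ?_)
  rw [hW]
  refine Eq.trans ?_ (h2.trans (map_zero _))
  rw [RingHom.comp_apply, ← map_sub]
  rfl

end Geometry

/-! ### Valuation rings and lifting of their spectra. -/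

section Valuations

open IsLocalRing

/-- The intersection of the valuation rings of `K` containing `k` is the integral closure of `k` in
`K`, which is `k` itself because `k` is algebraically closed. -/
lemma exists_valuationSubring_notMem {k K : Type*} [Field k] [IsAlgClosed k] [Field K]
    (φ : k →+* K) (x : K) (hx : ∀ c, φ c ≠ x) :
    ∃ R : ValuationSubring K, (∀ c, φ c ∈ R) ∧ x ∉ R := by
  by_contra! h
  algebraize [φ]
  have h1 : x ∈ (⨅ V : {V : ValuationSubring K // (φ.range : Set K) ⊆ V.toSubring},
      V.1.toSubring) := by
    refine (Subring.mem_iInf).2 fun V => h V.1 fun c => V.2 ⟨c, rfl⟩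
  rw [iInf_valuationSubring_superset, Subring.closure_eq] at h1
  have h2 : IsIntegral φ.range x := h1
  let : Algebra k φ.range := φ.rangeRestrict.toAlgebra
  have : IsScalarTower k φ.range K := .of_algebraMap_eq fun _ => rfl
  have : Algebra.IsIntegral k φ.range :=
    ⟨φ.rangeRestrict.isIntegral_of_surjective φ.rangeRestrict_surjective⟩
  have h3 : IsIntegral k x := isIntegral_trans x h2
  obtain ⟨c, hc⟩ := h3.mem_range_algebraMap_of_minpoly_splits (K := k) (IsAlgClosed.splits _)
  exact hx c hc

/-- The value of a global function at a point with values in a ring. -/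
def value {A : Type u} [CommRing A] {V : Scheme.{u}} (h : Spec (CommRingCat.of A) ⟶ V) :
    Γ(V, ⊤) →+* A :=
  (Scheme.ΓSpecIso (CommRingCat.of A)).hom.hom.comp h.appTop.hom

lemma value_comp {A : Type u} [CommRing A] {V W : Scheme.{u}}
    (h : Spec (CommRingCat.of A) ⟶ V) (g : V ⟶ W) (f : Γ(W, ⊤)) :
    value (h ≫ g) f = value h (g.appTop f) := by
  simp [value, -Scheme.Hom.comp_app, Scheme.Hom.comp_appTop]

lemma value_specMap {A B : Type u} [CommRing A] [CommRing B] (φ : A →+* B) {V : Scheme.{u}}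
    (h : Spec (CommRingCat.of A) ⟶ V) (f : Γ(V, ⊤)) :
    value (Spec.map (CommRingCat.ofHom φ) ≫ h) f = φ (value h f) := by
  rw [value_comp]
  exact congrArg (fun t => t.hom (h.appTop.hom f))
    (Scheme.ΓSpecIso_naturality (CommRingCat.ofHom φ))

lemma notMem_basicOpen_of_value_eq_zero {A : Type u} [CommRing A] {V : Scheme.{u}}
    (h : Spec (CommRingCat.of A) ⟶ V) (f : Γ(V, ⊤)) (hf : value h f = 0) (y) :
    h y ∉ V.basicOpen f := by
  have h1 : h.appTop f = 0 :=
    (Scheme.ΓSpecIso (CommRingCat.of A)).commRingCatIsoToRingEquiv.injective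
      (hf.trans (map_zero _).symm)
  intro hy
  have hy' : y ∈ h ⁻¹ᵁ V.basicOpen f := hy
  rw [Scheme.preimage_basicOpen_top, h1, Scheme.basicOpen_zero] at hy'
  exact hy'

/-- The valuative criterion for points with values in valuation subrings over an algebraically
closed base field. -/
lemma exists_lift_nonunit {k : Type u} [Field k] [IsAlgClosed k] {X : Scheme.{u}}
    (π : X ⟶ Spec (CommRingCat.of k)) [UniversallyClosed π] {K : Type u} [Field K] (φ : k →+* K)
    (y : Spec (CommRingCat.of K) ⟶ X) (hy : y ≫ π = Spec.map (CommRingCat.ofHom φ))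
    (x : K) (hx : ∀ c, φ c ≠ x) :
    ∃ (R : ValuationSubring K) (a : R) (l : Spec (CommRingCat.of R) ⟶ X), (a : K) = x ∧
      ¬ IsUnit a ∧ Spec.map (CommRingCat.ofHom (algebraMap R K)) ≫ l = y := by
  have hx0 : x ≠ 0 := fun h => hx 0 (by rw [map_zero, h])
  -- Excluding `x⁻¹` rather than `x` forces `x` into `R` as a nonunit.
  obtain ⟨R, hR, hxR⟩ := exists_valuationSubring_notMem φ x⁻¹ (fun c hc => hx c⁻¹ (by
    rw [map_inv₀, hc, inv_inv]))
  have hx' : x ∈ R := (R.mem_or_inv_mem x).resolve_right hxR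
  have hE : ValuativeCriterion.Existence π := by
    have h : UniversallyClosed π := ‹_›
    rw [UniversallyClosed.eq_valuativeCriterion] at h
    exact h.1
  have w : CommSq y (Spec.map (CommRingCat.ofHom (algebraMap R K))) π
      (Spec.map (CommRingCat.ofHom (φ.codRestrict R.toSubring hR))) := ⟨by
    rw [hy, ← Spec.map_comp]
    rfl⟩
  obtain ⟨⟨l⟩⟩ := hE ⟨R, K, y, _, w⟩
  refine ⟨R, ⟨x, hx'⟩, l.l, rfl, fun h => hxR ?_, l.fac_left⟩
  obtain ⟨b, hb⟩ := h.exists_right_inv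
  have hb' : x * (b : K) = 1 := congrArg Subtype.val hb
  rw [← eq_inv_of_mul_eq_one_right hb']
  exact b.2

/-- A specialization in `Q` is the image of the specialization of the generic to the closed point
of a valuation ring. -/
lemma exists_valuationSubring_of_specializes {Q : Scheme.{u}} {q' q : Q} (h : q' ⤳ q) :
    ∃ (A : ValuationSubring (Q.residueField q')) (t : Spec (CommRingCat.of A) ⟶ Q),
      t (closedPoint A) = q ∧
        Spec.map (CommRingCat.ofHom (algebraMap A (Q.residueField q'))) ≫ t =
          Q.fromSpecResidueField q' := by
  let r : Q.presheaf.stalk q ⟶ Q.residueField q' :=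
    Q.presheaf.stalkSpecializes h ≫ Q.residue q'
  -- A valuation ring of the residue field at `q'` dominating the local ring at `q`.
  obtain ⟨A, hA, hloc⟩ := exists_factor_valuationRing r.hom
  let r' : Q.presheaf.stalk q ⟶ CommRingCat.of A :=
    CommRingCat.ofHom (r.hom.codRestrict A.toSubring hA)
  have hr : r' ≫ CommRingCat.ofHom (algebraMap A (Q.residueField q')) = r := rfl
  have : IsLocalHom r'.hom := hloc
  refine ⟨A, Spec.map r' ≫ Q.fromSpecStalk q, ?_, ?_⟩
  · refine (Scheme.Hom.comp_apply _ _ _).trans ?_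
    have : Spec.map r' (closedPoint A) = closedPoint (Q.presheaf.stalk q) :=
      comap_closedPoint (S := A) r'.hom
    exact (congrArg _ this).trans Scheme.fromSpecStalk_closedPoint
  · rw [← Category.assoc, ← Spec.map_comp, hr, Spec.map_comp, Category.assoc,
      Scheme.SpecMap_stalkSpecializes_fromSpecStalk]
    rfl

/-- The two points are the kernels of `j` and of `R → K`, and the latter is zero. This allows `j` to
be extended to the fraction field. -/
lemma injective_of_comap_closedPoint_eq {R K L : Type*} [CommRing R] [Field K] [Field L]
    [Algebra R K] [FaithfulSMul R K] (j : R →+* L)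
    (h : PrimeSpectrum.comap j (closedPoint L) =
      PrimeSpectrum.comap (algebraMap R K) (closedPoint K)) : Function.Injective j := by
  rw [injective_iff_map_eq_zero]
  intro r hr
  have h1 : r ∈ (PrimeSpectrum.comap j (closedPoint L)).asIdeal := by
    change j r ∈ maximalIdeal L
    rw [hr]
    exact zero_mem _
  rw [h] at h1
  have h2 : algebraMap R K r ∈ maximalIdeal K := h1
  rw [maximalIdeal_eq_bot, Ideal.mem_bot] at h2
  exact FaithfulSMul.algebraMap_injective R K (h2.trans (map_zero _).symm)

/-- A point of `X` with values in a valuation ring lifts to any flat `U ⟶ X` whose image contains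
the image of the closed point, after a local extension of the valuation ring. -/
lemma exists_lift_of_flat {X U : Scheme.{u}} (g : U ⟶ X) [Flat g] {K : Type u} [Field K]
    (R : ValuationSubring K) (l : Spec (CommRingCat.of R) ⟶ X) (z : U)
    (hz : g z = l (closedPoint R)) :
    ∃ (K' : Type u) (_ : Field K') (R' : ValuationSubring K') (b : R →+* R') (_ : IsLocalHom b)
      (a : K →+* K') (t : Spec (CommRingCat.of R') ⟶ U), (∀ r : R, a r = b r) ∧
        t ≫ g = Spec.map (CommRingCat.ofHom b) ≫ l := by
  obtain ⟨q, hq1, hq2⟩ := Scheme.Pullback.exists_preimage_pullback (f := l) (g := g)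
    (closedPoint R) z hz.symm
  let p := pullback.fst l g
  let η : Spec (CommRingCat.of R) :=
    Spec.map (CommRingCat.ofHom (algebraMap R K)) (closedPoint K)
  have hη : η ⤳ p q := by
    rw [hq1]
    exact specializes_closedPoint (R := R) η
  -- Going down for the flat projection to `Spec R`: the point `q` over the closed point generalizes
  -- to a point `q'` over the generic point. A valuation ring realizing this specialization is the
  -- required extension of `R`.
  obtain ⟨q', hq', hq'η⟩ := Flat.generalizingMap p hη
  obtain ⟨A, t, ht, htq⟩ := exists_valuationSubring_of_specializes hq'
  obtain ⟨b, hb⟩ := Spec.map_surjective (t ≫ p)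
  have hbl : IsLocalHom b.hom := by
    rw [isLocalHom_iff_comap_closedPoint]
    change Spec.map b (closedPoint A) = closedPoint R
    rw [hb]
    exact (Scheme.Hom.comp_apply _ _ _).trans ((congrArg _ ht).trans hq1)
  let j : R →+* (pullback l g).residueField q' := (algebraMap A _).comp b.hom
  have h1 : Spec.map (CommRingCat.ofHom j) = (pullback l g).fromSpecResidueField q' ≫ p := by
    rw [← htq, Category.assoc, ← hb, ← Spec.map_comp]
    rfl
  have h2 : Spec.map (CommRingCat.ofHom j) (closedPoint ((pullback l g).residueField q')) = η := by
    rw [h1]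
    exact (Scheme.Hom.comp_apply _ _ _).trans
      ((congrArg _ (Scheme.fromSpecResidueField_apply _ _)).trans hq'η)
  have hj : Function.Injective j := injective_of_comap_closedPoint_eq (K := K) j h2
  refine ⟨_, inferInstance, A, b.hom, hbl, IsFractionRing.lift hj, t ≫ pullback.snd _ _,
    fun r => IsFractionRing.lift_algebraMap hj r, ?_⟩
  rw [Category.assoc, ← pullback.condition, ← Category.assoc, ← hb]
  rfl

end Valuations

/-! ### The functions attached to sections of `M` are locally constant. -/

section Constants

open IsLocalRing

/-- The constant functions on a scheme over a field. -/
def constants {k : Type u} [Field k] {V : Scheme.{u}} (p : V ⟶ Spec (CommRingCat.of k)) :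
    k →+* Γ(V, ⊤) :=
  p.appTop.hom.comp (Scheme.ΓSpecIso (CommRingCat.of k)).inv.hom

lemma value_constants {k : Type u} [Field k] {V : Scheme.{u}} (p : V ⟶ Spec (CommRingCat.of k))
    {A : Type u} [CommRing A] (h : Spec (CommRingCat.of A) ⟶ V) (φ : k →+* A)
    (hφ : h ≫ p = Spec.map (CommRingCat.ofHom φ)) (c : k) : value h (constants p c) = φ c := by
  refine (value_comp h p _).symm.trans ?_
  rw [hφ, ← Category.comp_id (Spec.map _), value_specMap]
  simp [value]

lemma appTop_constants {k : Type u} [Field k] {V W : Scheme.{u}}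
    (p : V ⟶ Spec (CommRingCat.of k)) (g : W ⟶ V) (p' : W ⟶ Spec (CommRingCat.of k))
    (h : g ≫ p = p') (c : k) : g.appTop (constants p c) = constants p' c := by
  subst h
  exact (congrArg (fun r => r.hom ((Scheme.ΓSpecIso (CommRingCat.of k)).inv.hom c))
    (Scheme.Hom.comp_appTop g p)).symm

lemma exists_mem_sieve {X : Scheme.{u}} {T : X.Etale} {S : Sieve T}
    (hS : S ∈ X.smallEtaleTopology T) (z : T.left) :
    ∃ (W : X.Etale) (g : W ⟶ T) (w : W.left), S g ∧ g.left w = z := by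
  obtain ⟨ι, Z, g, rfl⟩ := S.exists_eq_ofArrows
  rw [Scheme.ofArrows_mem_smallEtaleTopology_iff] at hS
  obtain ⟨i, w, hw⟩ := Set.mem_iUnion.1 (hS ▸ Set.mem_univ z)
  exact ⟨Z i, g i, w, Sieve.ofArrows_mk _ _ _, hw⟩

lemma mem_smallEtaleTopology {X : Scheme.{u}} {T : X.Etale} {S : Sieve T}
    (hS : ∀ z : T.left, ∃ (W : X.Etale) (g : W ⟶ T) (w : W.left), S g ∧ g.left w = z) :
    S ∈ X.smallEtaleTopology T := by
  choose W g w hg hw using hS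
  refine X.smallEtaleTopology.superset_covering ?_
    ((Scheme.ofArrows_mem_smallEtaleTopology_iff g).2 ?_)
  · rw [Sieve.ofArrows, Sieve.generate_le_iff]
    rintro _ _ ⟨z⟩
    exact hg z
  · exact Set.eq_univ_of_forall fun z => Set.mem_iUnion.2 ⟨z, w z, hw z⟩

variable {X : Scheme.{u}}

/-- The function underlying a section of the sheaf of units. -/
def unitsVal {V : X.Etale} : (unitsSheaf X).obj.obj (op V) →* Γ(V.left, ⊤) :=
  Units.coeHom Γ(V.left, ⊤)

lemma unitsVal_injective {V : X.Etale} : Function.Injective (unitsVal (V := V)) :=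
  Units.val_injective

lemma isUnit_unitsVal {V : X.Etale} (f : (unitsSheaf X).obj.obj (op V)) : IsUnit (unitsVal f) :=
  Units.isUnit _

lemma unitsVal_map {V W : X.Etale} (g : W ⟶ V) (f : (unitsSheaf X).obj.obj (op V)) :
    unitsVal ((unitsSheaf X).obj.map g.op f) = g.left.appTop (unitsVal f) := rfl

/-- Functions attached to sections of a coherent logarithmic structure on a scheme proper over an
algebraically closed field, and trivial on units, have constant values. -/
theorem exists_notMem_basicOpen_sub_constants {k : Type u} [Field k] [IsAlgClosed k]
    (π : X ⟶ Spec (CommRingCat.of k)) [UniversallyClosed π]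
    (M : LogStr (structureSheaf X)) (hM : M.IsCoherent) (Φ : M.M.obj ⟶ (unitsSheaf X).obj)
    (hΦ : ∀ (W : X.Etale) (e : M.M.obj.obj (op W)), IsUnit e → Φ.app (op W) e = 1)
    (V : X.Etale) (m : M.M.obj.obj (op V)) (v : V.left) :
    ∃ c, v ∉ V.left.basicOpen (unitsVal (Φ.app (op V) m) - constants (V := V.left) (V.hom ≫ π) c) := by
  by_contra! hc
  let f := unitsVal (Φ.app (op V) m)
  let K := V.left.residueField v
  let y : Spec (CommRingCat.of K) ⟶ V.left := V.left.fromSpecResidueField v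
  obtain ⟨φ, hφ⟩ := Spec.map_surjective (y ≫ V.hom ≫ π)
  have hval (c : k) : φ.hom c ≠ value y f := by
    intro h
    refine notMem_basicOpen_of_value_eq_zero y (f - constants (V := V.left) (V.hom ≫ π) c) ?_
      (closedPoint K) ?_
    · rw [map_sub, value_constants _ _ φ.hom hφ.symm, h, sub_self]
    · have h1 : y (closedPoint K) = v := Scheme.fromSpecResidueField_apply _ _
      exact (congrArg (· ∈ V.left.basicOpen _) h1).mpr (hc c)
  obtain ⟨R, a, l, ha, hau, hl⟩ := exists_lift_nonunit π φ.hom (y ≫ V.hom)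
    ((Category.assoc _ _ _).trans hφ.symm) (value y f) hval
  obtain ⟨U, z, hz, P, _, θ, -, hθ⟩ := hM (l (closedPoint R))
  obtain ⟨K', _, R', b, _, j, t, hj, ht⟩ := exists_lift_of_flat U.hom R l z hz
  let T : X.Etale := Scheme.Etale.mk (pullback.fst U.hom V.hom ≫ U.hom)
  let TU : T ⟶ U := MorphismProperty.Over.homMk (pullback.fst U.hom V.hom) rfl trivial
  let TV : T ⟶ V :=
    MorphismProperty.Over.homMk (pullback.snd U.hom V.hom) pullback.condition.symm trivial
  let i : R' →+* K' := algebraMap R' K'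
  have hij : j.comp (algebraMap R K) = i.comp b := RingHom.ext hj
  -- The `K'`-point of `U ×_X V` given by the generic point of `Spec R'` in `U` and by `v`. Through
  -- it the values of `f` and of `f'` can be compared.
  let τ : Spec (CommRingCat.of K') ⟶ T.left :=
    pullback.lift (Spec.map (CommRingCat.ofHom i) ≫ t) (Spec.map (CommRingCat.ofHom j) ≫ y) (by
      rw [Category.assoc, Category.assoc, ht, ← hl, ← Category.assoc, ← Category.assoc,
        ← Spec.map_comp, ← Spec.map_comp, ← CommRingCat.ofHom_comp, ← CommRingCat.ofHom_comp, hij])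
  have hτU : τ ≫ TU.left = Spec.map (CommRingCat.ofHom i) ≫ t := pullback.lift_fst _ _ _
  have hτV : τ ≫ TV.left = Spec.map (CommRingCat.ofHom j) ≫ y := pullback.lift_snd _ _ _
  obtain ⟨S, hS, hS'⟩ := hθ.exists_eq_mul M TU (M.M.obj.map TV.op m)
  obtain ⟨W, g, x, hg, hx⟩ := exists_mem_sieve hS (τ (closedPoint K'))
  obtain ⟨p, e, he, hpe⟩ := hS' g hg
  let f' := unitsVal (Φ.app (op U) (θ p))
  have nat {W' V' : X.Etale} (g : W' ⟶ V') (m : M.M.obj.obj (op V')) :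
      unitsVal (Φ.app (op W') (M.M.obj.map g.op m)) = g.left.appTop (unitsVal (Φ.app _ m)) :=
    (congrArg unitsVal (NatTrans.naturality_apply Φ g.op m)).trans (unitsVal_map g _)
  have hW : g.left.appTop (TV.left.appTop f) = g.left.appTop (TU.left.appTop f') := by
    have h1 : Φ.app (op W) (e * M.M.obj.map (g ≫ TU).op (θ p)) =
        Φ.app (op W) (M.M.obj.map (g ≫ TU).op (θ p)) := by
      rw [map_mul, hΦ W e he, one_mul]
    refine (((nat g _).trans (congrArg _ (nat TV m))).symm.trans
      (congrArg unitsVal ((congrArg _ hpe).trans h1))).trans ((nat (g ≫ TU) _).trans ?_)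
    exact congrArg (fun r => r.hom f') (Scheme.Hom.comp_appTop g.left TU.left)
  -- The covering member `W` need not have a `K'`-point over `τ`, so a further field extension `K''`
  -- is taken. The map `d` is injective, so the equality of values descends to `K'`.
  obtain ⟨n, -, -⟩ := Scheme.Pullback.exists_preimage_pullback (f := τ) (g := g.left)
    (closedPoint K') x hx.symm
  let N := pullback τ g.left
  let K'' := N.residueField n
  let s : Spec (CommRingCat.of K'') ⟶ N := N.fromSpecResidueField n
  obtain ⟨d, hd⟩ := Spec.map_surjective (s ≫ pullback.fst τ g.left)
  have hs {f : Γ(T.left, ⊤)} :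
      value (s ≫ pullback.snd τ g.left) (g.left.appTop f) = d.hom (value τ f) := by
    rw [← value_comp, Category.assoc, ← pullback.condition, ← Category.assoc, ← hd]
    exact value_specMap d.hom τ f
  have h1 := congrArg (value (s ≫ pullback.snd τ g.left)) hW
  rw [hs, hs, ← value_comp, ← value_comp, hτU, hτV, value_specMap, value_specMap] at h1
  have h2 : i (b a) = i (value t f') := by
    have h2 : j (a : K) = i (b a) := hj a
    rw [← h2, ha]
    exact d.hom.injective h1
  have h3 : b a = value t f' := Subtype.ext h2
  -- Here `f'` is invertible on all of `U`, so its value along `t` is a unit of `R'`, and `b` is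
  -- local.
  refine hau (IsUnit.of_map b a ?_)
  rw [h3]
  exact (isUnit_unitsVal _).map (value t)

/-- Functions as in `exists_notMem_basicOpen_sub_constants` are locally constant. -/
theorem exists_covering_eq_constants {k : Type u} [Field k] [IsAlgClosed k]
    (π : X ⟶ Spec (CommRingCat.of k)) [IsProper π] [IsReduced X]
    (M : LogStr (structureSheaf X)) (hM : M.IsCoherent) (Φ : M.M.obj ⟶ (unitsSheaf X).obj)
    (hΦ : ∀ (W : X.Etale) (e : M.M.obj.obj (op W)), IsUnit e → Φ.app (op W) e = 1)
    (V : X.Etale) (m : M.M.obj.obj (op V)) :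
    ∃ S ∈ X.smallEtaleTopology V, ∀ ⦃W : X.Etale⦄ (g : W ⟶ V), S g →
      ∃ c : kˣ, unitsVal (Φ.app (op W) (M.M.obj.map g.op m)) = constants (V := W.left) (W.hom ≫ π) c := by
  have : IsLocallyNoetherian X := LocallyOfFiniteType.isLocallyNoetherian π
  let q : V.left ⟶ X := V.hom
  have : AlgebraicGeometry.Etale q := V.prop
  have : IsLocallyNoetherian V.left := LocallyOfFiniteType.isLocallyNoetherian q
  have : IsReduced V.left := GeometricallyReduced.isReduced_of_flat_of_isLocallyNoetherian q
  have nat {W : X.Etale} (g : W ⟶ V) :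
      unitsVal (Φ.app (op W) (M.M.obj.map g.op m)) = g.left.appTop (unitsVal (Φ.app _ m)) :=
    (congrArg unitsVal (NatTrans.naturality_apply Φ g.op m)).trans (unitsVal_map g _)
  let S : Sieve V :=
    { arrows W g := ∃ c : kˣ, unitsVal (Φ.app (op W) (M.M.obj.map g.op m)) =
        constants (V := W.left) (W.hom ≫ π) c
      downward_closed := by
        rintro W W' g ⟨c, hc⟩ g'
        refine ⟨c, (nat _).trans ?_⟩
        have hg' : g'.left ≫ W.hom = W'.hom := MorphismProperty.Over.w (P := EtaleProp) g'
        refine Eq.trans ?_ (appTop_constants (V := W.left) (W.hom ≫ π) g'.left _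
          ((Category.assoc _ _ _).symm.trans (congrArg (· ≫ π) hg')) c)
        rw [← hc, nat]
        exact congrArg (fun r => r.hom (unitsVal (Φ.app _ m)))
          (Scheme.Hom.comp_appTop g'.left g.left) }
  refine ⟨S, mem_smallEtaleTopology fun v => ?_, fun W g hg => hg⟩
  obtain ⟨O, hv, c, hc⟩ := exists_res_sub_eq_zero (constants (q ≫ π)) (unitsVal (Φ.app _ m))
    (exists_notMem_basicOpen_sub_constants π M hM Φ hΦ V m) v
  let W : X.Etale := Scheme.Etale.mk (O.ι ≫ q)
  let g : W ⟶ V := MorphismProperty.Over.homMk O.ι rfl trivial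
  have h1 : unitsVal (Φ.app (op W) (M.M.obj.map g.op m)) =
      constants (V := W.left) (W.hom ≫ π) c := by
    exact (nat g).trans (hc.trans (appTop_constants (q ≫ π) O.ι _ (Category.assoc _ _ _).symm c))
  -- The constant equals an invertible function on `W`, which is nonempty because it contains `v`.
  have hc0 : c ≠ 0 := by
    rintro rfl
    rw [map_zero] at h1
    have h2 := isUnit_unitsVal (Φ.app (op W) (M.M.obj.map g.op m))
    rw [h1] at h2
    exact not_isUnit_zero ((value (W.left.fromSpecResidueField ⟨v, hv⟩)).map_zero ▸ h2.map _)
  exact ⟨W, g, ⟨v, hv⟩, ⟨Units.mk0 c hc0, h1⟩, rfl⟩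

end Constants

/-! ### Constant sections of the inverse image sheaf. -/

section InverseImage

variable {X S : Scheme.{u}}

/-- The empty sieve covers an empty scheme. This handles the case where distinct constants become
the same function. -/
lemma subsingleton_of_isEmpty (F : Sheaf X.smallEtaleTopology CommMonCat.{u}) (V : X.Etale)
    [IsEmpty V.left] : Subsingleton (F.obj.obj (op V)) := by
  have h : (⊥ : Sieve V) ∈ X.smallEtaleTopology V :=
    mem_smallEtaleTopology fun z => isEmptyElim z
  have hF : Presieve.IsSheaf X.smallEtaleTopology (F.obj ⋙ forget CommMonCat.{u}) :=
    (isSheaf_iff_isSheaf_of_type _ _).1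
      (Presheaf.isSheaf_comp_of_isSheaf _ F.obj (forget CommMonCat.{u}) F.property)
  exact ⟨fun a b => (hF _ h).isSeparatedFor.ext fun W f hf => hf.elim⟩

/-- The base scheme as an object of its étale site. -/
def etaleBase (S : Scheme.{u}) : S.Etale := Scheme.Etale.mk (𝟙 S)

/-- The map from an étale `V ⟶ X` to the base change of `S`. -/
def toBaseChange (π : X ⟶ S) (V : X.Etale) : V ⟶ (baseChange π).obj (etaleBase S) :=
  MorphismProperty.Over.homMk
    (pullback.lift (f := (etaleBase S).hom) (V.hom ≫ π) V.hom (Category.comp_id _))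
    (pullback.lift_snd _ _ _) trivial

lemma comp_toBaseChange (π : X ⟶ S) {V W : X.Etale} (g : W ⟶ V) :
    g ≫ toBaseChange π V = toBaseChange π W := by
  have hg : g.left ≫ V.hom = W.hom := MorphismProperty.Over.w (P := EtaleProp) g
  refine MorphismProperty.Over.Hom.ext ?_
  refine pullback.hom_ext ?_ ?_
  · exact (congrArg (g.left ≫ ·) (pullback.lift_fst _ _ _)).trans
      ((Category.assoc _ _ _).symm.trans ((congrArg (· ≫ π) hg).trans
        (pullback.lift_fst _ _ _).symm))
  · exact (congrArg (g.left ≫ ·) (pullback.lift_snd _ _ _)).trans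
      (hg.trans (pullback.lift_snd _ _ _).symm)

/-- The sections of `π^* 𝒪_S^*` given by the global units of `S`. -/
def constantSection (π : X ⟶ S) (V : X.Etale) :
    (unitsSheaf S).obj.obj (op (etaleBase S)) →* (inverseImageUnits π).obj.obj (op V) :=
  ((inverseImageUnits π).obj.map (toBaseChange π V).op).hom.comp
    (((((baseChange π).sheafAdjunctionContinuous CommMonCat.{u} S.smallEtaleTopology
      X.smallEtaleTopology).unit.app (unitsSheaf S)).hom.app (op (etaleBase S)))).hom

lemma map_constantSection (π : X ⟶ S) {V W : X.Etale} (g : W ⟶ V)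
    (s : (unitsSheaf S).obj.obj (op (etaleBase S))) :
    (inverseImageUnits π).obj.map g.op (constantSection π V s) = constantSection π W s := by
  have h : toBaseChange π W = g ≫ toBaseChange π V := (comp_toBaseChange π g).symm
  rw [constantSection, constantSection, h, op_comp, Functor.map_comp]
  rfl

/-- By adjunction, the unit followed by `inverseImageUnitsHom` is pullback of functions to the base
change; restricting to `V` gives pullback along `V ⟶ S`. -/
lemma inverseImageUnitsHom_constantSection (π : X ⟶ S) (V : X.Etale)
    (s : (unitsSheaf S).obj.obj (op (etaleBase S))) :
    unitsVal ((inverseImageUnitsHom π).hom.app (op V) (constantSection π V s)) =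
      Scheme.Hom.appTop (X := V.left) (V.hom ≫ π) (unitsVal s) := by
  let adj := (baseChange π).sheafAdjunctionContinuous CommMonCat.{u} S.smallEtaleTopology
      X.smallEtaleTopology
  have h1 : adj.unit.app (unitsSheaf S) ≫
      ((baseChange π).sheafPushforwardContinuous CommMonCat.{u} S.smallEtaleTopology
        X.smallEtaleTopology).map (inverseImageUnitsHom π) = unitsToPushforward π :=
    (adj.homEquiv_unit _ _ _).symm.trans (Equiv.apply_symm_apply _ _)
  have h2 := congrArg (fun t => (t.hom.app (op (etaleBase S))).hom s) h1
  refine (congrArg unitsVal ((NatTrans.naturality_apply (inverseImageUnitsHom π).hom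
    (toBaseChange π V).op _).trans (congrArg _ h2))).trans ?_
  refine (congrArg (fun r => r.hom (unitsVal s)) (Scheme.Hom.comp_appTop (toBaseChange π V).left
    (pullback.fst (etaleBase S).hom π))).symm.trans ?_
  refine congrArg (fun r => (Scheme.Hom.appTop r).hom (unitsVal s)) ?_
  exact pullback.lift_fst _ _ _

/-- If `V` is nonempty, the field `k` injects into the functions on `V`, so the image recovers the
constant; if `V` is empty there is only one section. -/
lemma constantSection_injOn {k : Type u} [Field k] (π : X ⟶ Spec (CommRingCat.of k))
    (V : X.Etale) : Set.InjOn ((inverseImageUnitsHom π).hom.app (op V))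
      (MonoidHom.mrange (constantSection π V)) := by
  rintro _ ⟨s, rfl⟩ _ ⟨t, rfl⟩ h
  cases isEmpty_or_nonempty V.left with
  | inl h' => exact (subsingleton_of_isEmpty _ V).elim _ _
  | inr h' =>
    obtain ⟨v⟩ := h'
    have h1 := congrArg unitsVal h
    rw [inverseImageUnitsHom_constantSection, inverseImageUnitsHom_constantSection] at h1
    let e := (Scheme.ΓSpecIso (CommRingCat.of k)).commRingCatIsoToRingEquiv
    let j : k →+* Γ(V.left, ⊤) := constants (V := V.left) (V.hom ≫ π)
    have hj : Function.Injective j := by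
      have : Nontrivial Γ(V.left, ⊤) := (value (V.left.fromSpecResidueField v)).domain_nontrivial
      exact j.injective
    have h2 (r : Γ(Spec (CommRingCat.of k), ⊤)) :
        Scheme.Hom.appTop (X := V.left) (V.hom ≫ π) r = j (e r) :=
      congrArg (Scheme.Hom.appTop (X := V.left) (V.hom ≫ π)) (e.symm_apply_apply r).symm
    have h3 : unitsVal s = unitsVal t := e.injective (hj ((h2 _).symm.trans (h1.trans (h2 _))))
    rw [unitsVal_injective h3]

end InverseImage

/-! ### Local lifting from the characteristic sheaf to `M`. -/

section Characteristic

variable {X : Scheme.{u}}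

/-- The quotient map from a logarithmic structure to its characteristic sheaf. -/
def LogStr.toCharacteristic (M : LogStr (structureSheaf X)) :
    M.M.obj ⟶ M.characteristic.obj :=
  { app U := CommMonCat.ofHom (Associates.mkMonoidHom (M := M.M.obj.obj U)) } ≫
    toSheafify X.smallEtaleTopology (M.M.obj ⋙ quotientByUnits)

lemma LogStr.toCharacteristic_eq_one (M : LogStr (structureSheaf X)) (V : X.Etale)
    (e : M.M.obj.obj (op V)) (he : IsUnit e) : M.toCharacteristic.app (op V) e = 1 := by
  have h : Associates.mk e = 1 := Associates.mk_eq_one.2 he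
  exact (congrArg ((toSheafify X.smallEtaleTopology (M.M.obj ⋙ quotientByUnits)).app _).hom h).trans
    (map_one _)

/-- The map to the sheafification is locally surjective, and the presheaf quotient by units is
surjective on sections. -/
lemma LogStr.exists_toCharacteristic_eq (M : LogStr (structureSheaf X)) (V : X.Etale)
    (x : M.characteristic.obj.obj (op V)) :
    ∃ S ∈ X.smallEtaleTopology V, ∀ ⦃W : X.Etale⦄ (g : W ⟶ V), S g →
      ∃ m, M.toCharacteristic.app (op W) m = M.characteristic.obj.map g.op x := by
  have h := Presheaf.imageSieve_mem X.smallEtaleTopology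
    (toSheafify X.smallEtaleTopology (M.M.obj ⋙ quotientByUnits)) (U := op V) x
  refine ⟨_, h, fun W g hg => ?_⟩
  obtain ⟨t, ht⟩ := hg
  obtain ⟨m, rfl⟩ := Associates.mk_surjective t
  exact ⟨m, ht⟩

end Characteristic

end LogUnits

end

/-- Let `X` be a reduced scheme, proper over `S = Spec k` with `k` an algebraically closed field,
and `M` a coherent logarithmic structure on `X`. Every homomorphism `M̄ ⟶ 𝒪_X^*` factors through
the canonical map `π^* 𝒪_S^* ⟶ 𝒪_X^*`. -/
theorem theorem7p1 (k : Type u) [Field k] [IsAlgClosed k] (X : Scheme.{u})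
    (π : X ⟶ Spec (CommRingCat.of k)) [IsProper π] [IsReduced X]
    (M : LogUnits.LogStr (LogUnits.structureSheaf X)) (hM : M.IsCoherent)
    (φ : M.characteristic ⟶ LogUnits.unitsSheaf X) :
    ∃ ψ : M.characteristic ⟶ LogUnits.inverseImageUnits π,
      ψ ≫ LogUnits.inverseImageUnitsHom π = φ := by
  let Φ := M.toCharacteristic ≫ φ.hom
  refine LogUnits.exists_factorization (LogUnits.inverseImageUnitsHom π) φ
    (fun V => MonoidHom.mrange (LogUnits.constantSection π V.unop)) ?_
    (fun V => LogUnits.constantSection_injOn π V.unop) fun V x => ?_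
  · rintro V W g _ ⟨s, rfl⟩
    exact ⟨s, (LogUnits.map_constantSection π g.unop s).symm⟩
  obtain ⟨S, hS, h⟩ := M.exists_toCharacteristic_eq V x
  choose m hm using h
  have hΦ (W : X.Etale) (e : M.M.obj.obj (op W)) (he : IsUnit e) : Φ.app (op W) e = 1 :=
    (congrArg (φ.hom.app (op W)).hom (M.toCharacteristic_eq_one W e he)).trans (map_one _)
  choose T hT hT' using fun ⦃W⦄ (g : W ⟶ V) (hg : S g) =>
    LogUnits.exists_covering_eq_constants π M hM Φ hΦ W (m g hg)
  -- First `x` is lifted locally to `M`, then each lift is refined until its image is constant.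
  refine ⟨Sieve.bind S T, X.smallEtaleTopology.bind_covering hS (fun _ _ hg => hT _ hg), ?_⟩
  rintro W _ ⟨Y, g, f, hf, hg, rfl⟩
  obtain ⟨c, hc⟩ := hT' f hf g hg
  -- The constant `c`, viewed as a global unit on `Spec k`.
  let s : (LogUnits.unitsSheaf (Spec (CommRingCat.of k))).obj.obj
      (op (LogUnits.etaleBase (Spec (CommRingCat.of k)))) :=
    Units.map (Scheme.ΓSpecIso (CommRingCat.of k)).inv.hom.toMonoidHom c
  refine ⟨LogUnits.constantSection π W s, ⟨s, rfl⟩, LogUnits.unitsVal_injective ?_⟩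
  rw [LogUnits.inverseImageUnitsHom_constantSection]
  refine hc.symm.trans (congrArg LogUnits.unitsVal ?_)
  refine congrArg (φ.hom.app (op W)).hom
    ((NatTrans.naturality_apply M.toCharacteristic g.op _).trans ?_)
  rw [op_comp, Functor.map_comp, hm]
  rfl
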